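/- Proposition 5.3. Let $k>0$ and $q\neq 0$ be integers, and let $K=J(k,2q)$ be the double twist knot, with knot group $$G(K)=\langle a,b \mid w_m^{\,q}a=b\,w_m^{\,q}\rangle,\qquad w_m=\begin{cases}(ba^{-1})^m(b^{-1}a)^m, & k=2m,\\ (ba^{-1})^m\,ba\,(b^{-1}a)^m, & k=2m+1,\end{cases}$$ and put $r=w_m^{\,q}\,a\,w_m^{-q}\,b^{-1}$. For a unit $s$ and an element $y$ of a commutative ring let $$\rho(a)=\begin{pmatrix}s&1\\0&s^{-1}\end{pmatrix},\qquad \rho(b)=\begin{pmatrix}s&0\\-y&s^{-1}\end{pmatrix},$$ let $\Phi$ be the ring homomorphism from the integral group ring of the free group on $a,b$ to the $2\times2$ matrices over the Laurent polynomials in $t$ given by $\Phi(a)=t\rho(a)$, $\Phi(b)=t\rho(b)$, and let $$\Delta_{K,\rho}(t)=\frac{\det\Phi(\partial r/\partial a)}{\det\Phi(1-b)}\qquad\text{or}\qquad \Delta_{K,\rho}(t)=\frac{\det\Phi(\partial r/\partial b)}{\det\Phi(1-a)}$$ (Fox derivatives) be the twisted Alexander polynomial, a rational function of $t$. Formed with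 indeterminates $s,y$, that is, over $\mathbb{Z}[s^{\pm1},y]$, either expression has the same nonzero coefficient $\psi_{k,q}(s,y)\in\mathbb{Z}[s^{\pm1},y]$ in its highest degree term, in the same degree $n$ in $t$ (terms being those of the expansion in descending powers of $t$). For all complex numbers $s\neq0$ and $y$ such that $\rho$ defines a representation $G(K)\to SL(2,\mathbb{C})$, the rational function $\Delta_{K,\rho}(t)$ has degree at most $n$, and its coefficient of $t^n$ is $\psi_{k,q}(s,y)$. Let $\deg\psi_{k,q}$ be the largest $i+j$ over the monomials $s^iy^j$ that occur in $\psi_{k,q}(s,y)$. Then $$\deg\psi_{k,q}(s,y)=\begin{cases}(k+1)|q|-\frac{k+4}{2}, & k \text{ even};\\ \frac{k-3}{2}, & k\neq1 \text{ odd},\ q>0;\\ \frac{k-1}{2}, & k \text{ odd},\ q<0;\\ 0, & k=1,\ q>0.\end{cases}$$ -/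

import Mathlib

open scoped LaurentPolynomial MatrixGroups

namespace DoubleTwist

noncomputable section

/-! ### Fox calculus and Wada's invariant for a presentation `⟨a, b | r⟩`

The free group on `a = x₀` and `b = x₁` is `FreeGroup (Fin 2)`. -/

/-- Left multiplication of the free group on (the additive group of) its integral group ring. -/
def leftMul :
    FreeGroup (Fin 2) →* MulAut (Multiplicative (MonoidAlgebra ℤ (FreeGroup (Fin 2)))) where
  toFun g := AddEquiv.toMultiplicative
    { toFun := fun z => MonoidAlgebra.of ℤ _ g * z
      invFun := fun z => MonoidAlgebra.of ℤ _ g⁻¹ * z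
      left_inv := fun z => by
        simp [← mul_assoc, MonoidAlgebra.single_mul_single, ← MonoidAlgebra.one_def]
      right_inv := fun z => by
        simp [← mul_assoc, MonoidAlgebra.single_mul_single, ← MonoidAlgebra.one_def]
      map_add' := mul_add _ }
  map_one' := by
    refine MulEquiv.ext fun z => ?_
    exact congrArg Multiplicative.ofAdd
      (by rw [map_one, one_mul] : MonoidAlgebra.of ℤ (FreeGroup (Fin 2)) 1 * z.toAdd = z.toAdd)
  map_mul' g h := by
    refine MulEquiv.ext fun z => ?_
    exact congrArg Multiplicative.ofAdd
      (by rw [map_mul, mul_assoc] : MonoidAlgebra.of ℤ (FreeGroup (Fin 2)) (g * h) * z.toAdd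
        = MonoidAlgebra.of ℤ _ g * (MonoidAlgebra.of ℤ _ h * z.toAdd))

/-- The homomorphism `w ↦ (∂w/∂xᵢ, w)` from the free group to `ℤ[F] ⋊ F` that sends `xⱼ` to
`(δᵢⱼ, xⱼ)`. -/
def foxHom (i : Fin 2) : FreeGroup (Fin 2) →*
    SemidirectProduct (Multiplicative (MonoidAlgebra ℤ (FreeGroup (Fin 2))))
      (FreeGroup (Fin 2)) leftMul :=
  FreeGroup.lift fun j => ⟨Multiplicative.ofAdd (if i = j then 1 else 0), FreeGroup.of j⟩

/-- The Fox derivative `∂w/∂xᵢ ∈ ℤ[F]`. -/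
def foxDeriv (i : Fin 2) (w : FreeGroup (Fin 2)) : MonoidAlgebra ℤ (FreeGroup (Fin 2)) :=
  (foxHom i w).left.toAdd

theorem foxHom_right (i : Fin 2) (w : FreeGroup (Fin 2)) : (foxHom i w).right = w := by
  have h : SemidirectProduct.rightHom.comp (foxHom i) = MonoidHom.id _ := by
    ext j
    simp [foxHom]
  exact DFunLike.congr_fun h w

theorem foxDeriv_of (i j : Fin 2) :
    foxDeriv i (FreeGroup.of j) = if i = j then 1 else 0 := by
  simp [foxDeriv, foxHom]

/-- The product rule `∂(uv)/∂xᵢ = ∂u/∂xᵢ + u ∂v/∂xᵢ`; with `foxDeriv_of` it characterizes the Fox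
derivative. -/
theorem foxDeriv_mul (i : Fin 2) (u v : FreeGroup (Fin 2)) :
    foxDeriv i (u * v) = foxDeriv i u + MonoidAlgebra.of ℤ _ u * foxDeriv i v := by
  simp only [foxDeriv, map_mul, SemidirectProduct.mul_left, foxHom_right, toAdd_mul]
  rfl

/-- The homomorphism `F → ⟨t⟩`, `a, b ↦ t`. -/
def alpha (R : Type*) [CommRing R] : FreeGroup (Fin 2) →* R[T;T⁻¹] :=
  ((AddMonoidAlgebra.of R ℤ).comp
    (FreeGroup.lift fun _ => Multiplicative.ofAdd (1 : ℤ)) : FreeGroup (Fin 2) →* R[T;T⁻¹])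

/-- The homomorphism `F → M(2, R[t^{±1}])`, `w ↦ α(w) ρ(w)`. -/
def rhoAlpha {R : Type*} [CommRing R] (ρ : FreeGroup (Fin 2) →* SL(2, R)) :
    FreeGroup (Fin 2) →* Matrix (Fin 2) (Fin 2) R[T;T⁻¹] where
  toFun w := alpha R w • (ρ w : Matrix (Fin 2) (Fin 2) R).map LaurentPolynomial.C
  map_one' := by simp
  map_mul' u v := by
    rw [map_mul, map_mul, Matrix.SpecialLinearGroup.coe_mul, Matrix.map_mul, smul_mul_smul_comm]

/-- The ring homomorphism `Φ : ℤ[F] → M(2, R[t^{±1}])` induced by `ρ ⊗ α`. -/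
def Phi {R : Type*} [CommRing R] (ρ : FreeGroup (Fin 2) →* SL(2, R)) :
    MonoidAlgebra ℤ (FreeGroup (Fin 2)) →+* Matrix (Fin 2) (Fin 2) R[T;T⁻¹] :=
  (MonoidAlgebra.lift ℤ (Matrix (Fin 2) (Fin 2) R[T;T⁻¹]) (FreeGroup (Fin 2))
    (rhoAlpha ρ)).toRingHom

/-- Wada's invariant `det M_j / det Φ(1 - xⱼ)` of the presentation `⟨x₀, x₁ | r⟩`, a rational
function in `t`. The Alexander matrix is `(Φ(∂r/∂x₀), Φ(∂r/∂x₁))`, and `M_j`, obtained by deleting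
column `j`, is `Φ(∂r/∂x_{1-j})`. A representation of `⟨x₀, x₁ | r⟩` is entered through its
composition with the projection from the free group. -/
def twistedAlexander {R : Type*} [CommRing R] [IsDomain R] (r : FreeGroup (Fin 2))
    (ρ : FreeGroup (Fin 2) →* SL(2, R)) (j : Fin 2) : FractionRing R[T;T⁻¹] :=
  algebraMap R[T;T⁻¹] _ (Phi ρ (foxDeriv (1 - j) r)).det /
    algebraMap R[T;T⁻¹] _ (Phi ρ (1 - MonoidAlgebra.of ℤ _ (FreeGroup.of j))).det

/-- The rational function `f` of `t` has degree at most `n`, and `c` is the coefficient of `t ^ n`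
in its expansion in descending powers of `t`: `f = P / Q` with `Q` monic of some degree `m`,
`deg P ≤ n + m`, and `c` the coefficient of `t ^ (n + m)` in `P`. If moreover `c ≠ 0`, then `c` is
the coefficient of the highest degree term of `f` (and `n` is the degree). -/
def HasTopTerm {R : Type*} [CommRing R] [IsDomain R] (f : FractionRing R[T;T⁻¹]) (n : ℤ) (c : R) :
    Prop :=
  ∃ (P Q : R[T;T⁻¹]) (m : ℤ),
    f = algebraMap R[T;T⁻¹] _ P / algebraMap R[T;T⁻¹] _ Q ∧
    Q.coeff m = 1 ∧ (∀ i, m < i → Q.coeff i = 0) ∧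
    P.coeff (n + m) = c ∧ (∀ i, n + m < i → P.coeff i = 0)

/-! ### The group of `J(k, 2q)` and its representations -/

/-- `w_m = (ba⁻¹)^m (b⁻¹a)^m` for `k = 2m`, and `w_m = (ba⁻¹)^m ba (b⁻¹a)^m` for `k = 2m + 1`. -/
def word (k : ℕ) : FreeGroup (Fin 2) :=
  let a : FreeGroup (Fin 2) := FreeGroup.of 0
  let b : FreeGroup (Fin 2) := FreeGroup.of 1
  if Even k then (b * a⁻¹) ^ (k / 2) * (b⁻¹ * a) ^ (k / 2)
  else (b * a⁻¹) ^ (k / 2) * (b * a) * (b⁻¹ * a) ^ (k / 2)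

/-- The relator `r = w_m^q a w_m^{-q} b⁻¹`, for the relation `w_m^q a = b w_m^q`. -/
def relator (k : ℕ) (q : ℤ) : FreeGroup (Fin 2) :=
  word k ^ q * FreeGroup.of 0 * word k ^ (-q) * (FreeGroup.of 1)⁻¹

/-- The knot group `⟨a, b | w_m^q a = b w_m^q⟩` of `J(k, 2q)`. -/
abbrev knotGroup (k : ℕ) (q : ℤ) : Type := PresentedGroup {relator k q}

variable {R : Type*} [CommRing R]

/-- The image of `a`. -/
def matA (s : Rˣ) : SL(2, R) :=
  ⟨!![(s : R), 1; 0, ((s⁻¹ : Rˣ) : R)], by simp [Matrix.det_fin_two_of]⟩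

/-- The image of `b`. -/
def matB (s : Rˣ) (y : R) : SL(2, R) :=
  ⟨!![(s : R), 0; -y, ((s⁻¹ : Rˣ) : R)], by simp [Matrix.det_fin_two_of]⟩

/-- `a ↦ A`, `b ↦ B` on the free group. -/
def rileyRep (s : Rˣ) (y : R) : FreeGroup (Fin 2) →* SL(2, R) :=
  FreeGroup.lift ![matA s, matB s y]

/-! ### Polynomials in `s^{±1}` and `y` -/

/-- The ring `ℤ[s^{±1}, y] = ℤ[s^{±1}][y]`. -/
abbrev PolySY : Type := Polynomial ℤ[T;T⁻¹]

/-- The indeterminate `s` as a unit of `ℤ[s^{±1}, y]`. -/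
def indetS : PolySYˣ :=
  ⟨Polynomial.C (LaurentPolynomial.T 1), Polynomial.C (LaurentPolynomial.T (-1)),
    by rw [← map_mul, ← LaurentPolynomial.T_add]; simp,
    by rw [← map_mul, ← LaurentPolynomial.T_add]; simp⟩

/-- The universal assignment: `s` and `y` are the indeterminates. -/
def universalRep : FreeGroup (Fin 2) →* SL(2, PolySY) :=
  rileyRep indetS Polynomial.X

/-- Evaluation of a polynomial in `s^{±1}, y` at complex numbers `s ≠ 0` and `y`. -/
def evalSY (s : ℂˣ) (y : ℂ) : PolySY →+* ℂ :=
  Polynomial.eval₂RingHom (LaurentPolynomial.eval₂ (Int.castRingHom ℂ) s) y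

/-- The degree in `s` and `y` together: the largest `i + j` over the monomials `s^i y^j` that occur
(`⊥` for the zero polynomial). -/
def degSY (ψ : PolySY) : WithBot ℤ :=
  ψ.support.sup fun j => (ψ.coeff j).degree + ((j : ℤ) : WithBot ℤ)

end

end DoubleTwist

open DoubleTwist

/-! The proof reads off the top coefficient in `t` by Fox calculus, then measures it with a grading
of `ℤ[s^{±1}, y]`. Write `U = ba⁻¹`, `V = b⁻¹a`, `m = k / 2` (rounded down), and `S_n(g) = 1 + ρ(g)
+ ⋯ + ρ(g)^(n-1)`. Since `Φ(g)` is `ρ(g)` times a power of `t`, top coefficients of matrices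
multiply, and every group element contributes determinant 1. Only geometric sums survive. For even
`k`, `w` has exponent sum 0 and the coefficient is `det S_{|q|}(w) · det S_m(U)`. For odd `k` the
exponent sum is 2, so one power of `w` dominates its geometric sum; what remains is `det S_{m+1}(V)`
for `q < 0` and `det S_m(V)` for `q > 0`. The last vanishes for `k = 1`, where the true top term
lies two degrees lower and has coefficient 1. The denominator has top term `t²`. All this holds for
any representation of the free group over a commutative ring (`hasTop_det_foxDeriv_relator`), and
the coefficient commutes with ring homomorphisms (`map_leadCoeff`), which gives the statement about
complex `s`, `y`. For the degree, substitute `s = T`, `y = XT`, so that total degree becomes degree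
in `T` (`degSY_eq_of_hasTop`). If `M ∈ SL₂` has trace of degree `d > 0`, Cayley–Hamilton shows that
`det (1 + M + ⋯ + M^n)` has top coefficient the `n`-th power of that of the trace, in degree `dn`
(`hasTop_det_geomSum`). The traces of `U` and `V` have degree 1, and for even `k` that of `w` has
degree `k + 1` (`hasTop_trace_word_even`). -/

open DoubleTwist

namespace DoubleTwist

/-! ### Top coefficients of Laurent polynomials and of matrices over them. -/

section LeadingCoefficients

variable {R : Type*} [CommRing R]

/-- The Laurent polynomial `f` has no terms above degree `d`, and `c` is its coefficient in
degree `d` (possibly zero). -/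
def HasTop (f : R[T;T⁻¹]) (d : ℤ) (c : R) : Prop :=
  f.coeff d = c ∧ ∀ i, d < i → f.coeff i = 0

namespace HasTop

variable {f g : R[T;T⁻¹]} {d e : ℤ} {c c' : R}

theorem zero (d : ℤ) : HasTop (0 : R[T;T⁻¹]) d 0 := ⟨by simp, by simp⟩

/-- Terms of smaller degree are discarded by viewing them with coefficient 0 in the larger degree.
-/
theorem lower (h : HasTop f d c) (hde : d < e) : HasTop f e 0 :=
  ⟨h.2 e hde, fun i hi => h.2 i (hde.trans hi)⟩

theorem add (hf : HasTop f d c) (hg : HasTop g d c') : HasTop (f + g) d (c + c') :=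
  ⟨by simp [hf.1, hg.1], fun i hi => by simp [hf.2 i hi, hg.2 i hi]⟩

theorem neg (hf : HasTop f d c) : HasTop (-f) d (-c) :=
  ⟨by simp [hf.1], fun i hi => by simp [hf.2 i hi]⟩

theorem sub (hf : HasTop f d c) (hg : HasTop g d c') : HasTop (f - g) d (c - c') := by
  simpa only [sub_eq_add_neg] using hf.add hg.neg

theorem mul (hf : HasTop f d c) (hg : HasTop g e c') : HasTop (f * g) (d + e) (c * c') := by
  classical
  -- Away from `(d, e)`, exponents with sum at least `d + e` satisfy `i > d` or `j > e`.
  have hvan : ∀ i j, d + e ≤ i + j → i ≠ d ∨ j ≠ e → f.coeff i * g.coeff j = 0 := by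
    intro i j hij hne
    by_cases hi : d < i
    · simp [hf.2 i hi]
    · have hj : e < j := by omega
      simp [hg.2 j hj]
  constructor
  · rw [AddMonoidAlgebra.coeff_mul, Finsupp.sum, Finset.sum_eq_single d, Finsupp.sum,
      Finset.sum_eq_single e]
    · simp [hf.1, hg.1]
    · intro j _ hj
      split_ifs with h
      · exact hvan _ _ h.ge (Or.inr hj)
      · rfl
    · intro h
      simp [Finsupp.notMem_support_iff.mp h]
    · intro i _ hi
      refine Finset.sum_eq_zero fun j _ => ?_
      dsimp only
      split_ifs with h
      · exact hvan _ _ h.ge (Or.inl hi)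
      · rfl
    · intro h
      simp [Finsupp.notMem_support_iff.mp h]
  · intro n hn
    rw [AddMonoidAlgebra.coeff_mul]
    refine Finset.sum_eq_zero fun i _ => Finset.sum_eq_zero fun j _ => ?_
    dsimp only
    split_ifs with h
    · exact hvan _ _ (by omega) (by omega)
    · rfl

theorem C_mul_T (c : R) (d : ℤ) :
    HasTop (LaurentPolynomial.C c * LaurentPolynomial.T d) d c := by
  rw [← LaurentPolynomial.single_eq_C_mul_T]
  exact ⟨by rw [AddMonoidAlgebra.coeff_single, Finsupp.single_eq_same],
    fun i hi => by rw [AddMonoidAlgebra.coeff_single, Finsupp.single_eq_of_ne hi.ne']⟩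

theorem T (d : ℤ) : HasTop (LaurentPolynomial.T d : R[T;T⁻¹]) d 1 := by
  simpa using C_mul_T (1 : R) d

theorem C (c : R) : HasTop (LaurentPolynomial.C c : R[T;T⁻¹]) 0 c := by
  simpa using C_mul_T c 0

theorem one : HasTop (1 : R[T;T⁻¹]) 0 1 := by
  simpa using C (1 : R)

theorem sum {ι : Type*} (s : Finset ι) {F : ι → R[T;T⁻¹]} {N : ι → R}
    (h : ∀ i ∈ s, HasTop (F i) d (N i)) : HasTop (∑ i ∈ s, F i) d (∑ i ∈ s, N i) := by
  classical
  induction s using Finset.induction_on with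
  | empty => simpa using zero d
  | insert a s ha ih =>
    rw [Finset.sum_insert ha, Finset.sum_insert ha]
    exact (h a (Finset.mem_insert_self a s)).add
      (ih fun i hi => h i (Finset.mem_insert_of_mem hi))

end HasTop

/-- Entrywise version of `HasTop`. -/
def MatTop (M : Matrix (Fin 2) (Fin 2) R[T;T⁻¹]) (d : ℤ) (N : Matrix (Fin 2) (Fin 2) R) : Prop :=
  ∀ i j, HasTop (M i j) d (N i j)

namespace MatTop

variable {M M' : Matrix (Fin 2) (Fin 2) R[T;T⁻¹]} {N N' : Matrix (Fin 2) (Fin 2) R} {d e : ℤ}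

theorem zero (d : ℤ) : MatTop (0 : Matrix (Fin 2) (Fin 2) R[T;T⁻¹]) d 0 :=
  fun _ _ => HasTop.zero d

theorem lower (h : MatTop M d N) (hde : d < e) : MatTop M e 0 :=
  fun i j => (h i j).lower hde

theorem add (h : MatTop M d N) (h' : MatTop M' d N') : MatTop (M + M') d (N + N') :=
  fun i j => (h i j).add (h' i j)

theorem neg (h : MatTop M d N) : MatTop (-M) d (-N) :=
  fun i j => (h i j).neg

theorem sub (h : MatTop M d N) (h' : MatTop M' d N') : MatTop (M - M') d (N - N') :=
  fun i j => (h i j).sub (h' i j)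

theorem mul (h : MatTop M d N) (h' : MatTop M' e N') : MatTop (M * M') (d + e) (N * N') :=
  fun i j => by
    rw [Matrix.mul_apply, Matrix.mul_apply]
    exact HasTop.sum _ fun k _ => (h i k).mul (h' k j)

theorem one : MatTop (1 : Matrix (Fin 2) (Fin 2) R[T;T⁻¹]) 0 1 := fun i j => by
  rw [Matrix.one_apply, Matrix.one_apply]
  split_ifs
  · exact HasTop.one
  · exact HasTop.zero 0

theorem pow (h : MatTop M d N) (n : ℕ) : MatTop (M ^ n) (d * n) (N ^ n) := by
  induction n with
  | zero => simpa using one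
  | succ n ih =>
    rw [pow_succ, pow_succ]
    convert ih.mul h using 1
    push_cast
    ring

theorem det (h : MatTop M d N) : HasTop M.det (2 * d) N.det := by
  rw [Matrix.det_fin_two, Matrix.det_fin_two, two_mul]
  exact ((h 0 0).mul (h 1 1)).sub ((h 0 1).mul (h 1 0))

/-- The geometric sum of a matrix of degree `0`. -/
theorem geomSum_of_zero (h : MatTop M 0 N) (n : ℕ) :
    MatTop (∑ l ∈ Finset.range n, M ^ l) 0 (∑ l ∈ Finset.range n, N ^ l) := by
  induction n with
  | zero => simpa using zero 0
  | succ n ih =>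
    rw [Finset.sum_range_succ, Finset.sum_range_succ]
    have := h.pow n
    rw [zero_mul] at this
    exact ih.add this

/-- The geometric sum of a matrix of positive degree. -/
theorem geomSum_of_pos (h : MatTop M d N) (hd : 0 < d) (n : ℕ) :
    MatTop (∑ l ∈ Finset.range (n + 1), M ^ l) (d * n) (N ^ n) := by
  induction n with
  | zero => simpa using one
  | succ n ih =>
    rw [Finset.sum_range_succ]
    have h1 := (ih.lower (e := d * ((n + 1 : ℕ) : ℤ)) (by push_cast; nlinarith)).add
      (h.pow (n + 1))
    simpa using h1

end MatTop

end LeadingCoefficients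

/-! ### Fox derivatives of powers and of the relator. -/

section FoxCalculus

/-- A word in the free group as an element of the group ring. -/
local notation "ι" => MonoidAlgebra.of ℤ (FreeGroup (Fin 2))

theorem foxDeriv_one (i : Fin 2) : foxDeriv i 1 = 0 := by
  have h := foxDeriv_mul i 1 1
  rw [map_one, one_mul, one_mul] at h
  exact left_eq_add.mp h

theorem foxDeriv_inv (i : Fin 2) (g : FreeGroup (Fin 2)) :
    foxDeriv i g⁻¹ = -(ι g⁻¹ * foxDeriv i g) := by
  have h := foxDeriv_mul i g⁻¹ g
  rw [inv_mul_cancel, foxDeriv_one] at h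
  exact eq_neg_of_add_eq_zero_left h.symm

theorem foxDeriv_pow (i : Fin 2) (g : FreeGroup (Fin 2)) (n : ℕ) :
    foxDeriv i (g ^ n) = (∑ l ∈ Finset.range n, ι g ^ l) * foxDeriv i g := by
  induction n with
  | zero => simp [foxDeriv_one]
  | succ n ih => rw [pow_succ, foxDeriv_mul, ih, Finset.sum_range_succ, add_mul, map_pow]

/-- Because `∂(w^{-q}) = -w^{-q} ∂(w^q)`, the two occurrences of `∂(w^q)` combine into one with
factor `1 - w^q a w^{-q}`. -/
theorem foxDeriv_relator (i : Fin 2) (k : ℕ) (q : ℤ) :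
    foxDeriv i (relator k q) =
      (1 - ι (word k ^ q * FreeGroup.of 0 * word k ^ (-q))) * foxDeriv i (word k ^ q) +
        ((if i = 0 then ι (word k ^ q) else 0) - if i = 1 then ι (relator k q) else 0) := by
  rw [relator, foxDeriv_mul, foxDeriv_mul, foxDeriv_mul, zpow_neg, foxDeriv_inv, foxDeriv_inv,
    foxDeriv_of, foxDeriv_of, ← zpow_neg]
  fin_cases i <;> simp [mul_assoc, sub_mul, -MonoidAlgebra.of_apply] <;> abel

end FoxCalculus

/-! ### Top coefficients of the derivatives of the words. -/

section TopTerms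

variable {R : Type*} [CommRing R]

local notation "ι" => MonoidAlgebra.of ℤ (FreeGroup (Fin 2))

/-- The exponent sum of a word. -/
def expSum (g : FreeGroup (Fin 2)) : ℤ :=
  (FreeGroup.lift (fun _ => Multiplicative.ofAdd (1 : ℤ)) g).toAdd

theorem expSum_of (j : Fin 2) : expSum (FreeGroup.of j) = 1 := by simp [expSum]

theorem expSum_mul (g h : FreeGroup (Fin 2)) : expSum (g * h) = expSum g + expSum h := by
  simp [expSum]

theorem expSum_inv (g : FreeGroup (Fin 2)) : expSum g⁻¹ = -expSum g := by simp [expSum]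

theorem expSum_pow (g : FreeGroup (Fin 2)) (n : ℕ) : expSum (g ^ n) = n * expSum g := by
  simp [expSum]

theorem expSum_zpow (g : FreeGroup (Fin 2)) (n : ℤ) : expSum (g ^ n) = n * expSum g := by
  simp [expSum]

/-- A representation of the free group in `SL(2, R)`, with values in the matrix ring. -/
def repMat (ρ : FreeGroup (Fin 2) →* SL(2, R)) :
    FreeGroup (Fin 2) →* Matrix (Fin 2) (Fin 2) R where
  toFun g := ρ g
  map_one' := by simp
  map_mul' := by simp

theorem det_repMat (ρ : FreeGroup (Fin 2) →* SL(2, R)) (g : FreeGroup (Fin 2)) :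
    (repMat ρ g).det = 1 :=
  (ρ g).2

variable (ρ : FreeGroup (Fin 2) →* SL(2, R))

theorem matTop_Phi_of (g : FreeGroup (Fin 2)) :
    MatTop (Phi ρ (ι g)) (expSum g) (repMat ρ g) := fun i j => by
  have h : Phi ρ (ι g) = rhoAlpha ρ g := by simp [Phi]
  have h' : alpha R g = LaurentPolynomial.T (expSum g) := rfl
  have := (HasTop.T (R := R) (expSum g)).mul (HasTop.C (repMat ρ g i j))
  rw [h]
  simpa [rhoAlpha, h', repMat] using this

/-- `Phi ρ` of a word whose exponent sum is known. -/
theorem matTop_Phi_of_eq {g : FreeGroup (Fin 2)} {d : ℤ} (hd : expSum g = d) :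
    MatTop (Phi ρ (ι g)) d (repMat ρ g) :=
  hd ▸ matTop_Phi_of ρ g

theorem Phi_geomSum (g : FreeGroup (Fin 2)) (n : ℕ) :
    Phi ρ (∑ l ∈ Finset.range n, ι g ^ l) = ∑ l ∈ Finset.range n, Phi ρ (ι g) ^ l := by
  simp only [map_sum, map_pow]

/-- `S_n(ρ(g)) = 1 + ρ(g) + ⋯ + ρ(g)^(n-1)`. -/
def geomMat (n : ℕ) (g : FreeGroup (Fin 2)) : Matrix (Fin 2) (Fin 2) R :=
  ∑ l ∈ Finset.range n, repMat ρ g ^ l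

/-- The word `ba⁻¹`. -/
def wordU : FreeGroup (Fin 2) := FreeGroup.of 1 * (FreeGroup.of 0)⁻¹

/-- The word `b⁻¹a`. -/
def wordV : FreeGroup (Fin 2) := (FreeGroup.of 1)⁻¹ * FreeGroup.of 0

theorem word_even (m : ℕ) : word (2 * m) = wordU ^ m * wordV ^ m := by
  simp [word, wordU, wordV]

theorem word_odd (m : ℕ) :
    word (2 * m + 1) = wordU ^ m * (FreeGroup.of 1 * FreeGroup.of 0) * wordV ^ m := by
  have h : (2 * m + 1) / 2 = m := by omega
  simp [word, wordU, wordV, h]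

theorem expSum_wordU : expSum wordU = 0 := by simp [wordU, expSum_mul, expSum_inv, expSum_of]

theorem expSum_wordV : expSum wordV = 0 := by simp [wordV, expSum_mul, expSum_inv, expSum_of]

theorem expSum_word_even (m : ℕ) : expSum (word (2 * m)) = 0 := by
  simp [word_even, expSum_mul, expSum_pow, expSum_wordU, expSum_wordV]

theorem expSum_word_odd (m : ℕ) : expSum (word (2 * m + 1)) = 2 := by
  simp [word_odd, expSum_mul, expSum_pow, expSum_wordU, expSum_wordV, expSum_of]

theorem foxDeriv_wordU (i : Fin 2) : foxDeriv i wordU = if i = 0 then -ι wordU else 1 := by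
  rw [wordU, foxDeriv_mul, foxDeriv_inv, foxDeriv_of, foxDeriv_of]
  fin_cases i <;> simp [MonoidAlgebra.single_mul_single]

theorem foxDeriv_wordV (i : Fin 2) :
    foxDeriv i wordV = if i = 0 then ι (FreeGroup.of 1)⁻¹ else -ι (FreeGroup.of 1)⁻¹ := by
  rw [wordV, foxDeriv_mul, foxDeriv_inv, foxDeriv_of, foxDeriv_of]
  fin_cases i <;> simp

/-- Leading coefficient of `Φ(∂(ba⁻¹)/∂xᵢ)`. -/
def topU (i : Fin 2) : Matrix (Fin 2) (Fin 2) R := if i = 0 then -repMat ρ wordU else 1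

theorem matTop_foxDeriv_wordU (i : Fin 2) : MatTop (Phi ρ (foxDeriv i wordU)) 0 (topU ρ i) := by
  rw [foxDeriv_wordU, topU]
  split_ifs
  · rw [map_neg]
    exact (matTop_Phi_of_eq ρ expSum_wordU).neg
  · rw [map_one]
    exact MatTop.one

/-- Leading coefficient of `Φ(∂(b⁻¹a)/∂xᵢ)`. -/
def topV (i : Fin 2) : Matrix (Fin 2) (Fin 2) R :=
  if i = 0 then repMat ρ (FreeGroup.of 1)⁻¹ else -repMat ρ (FreeGroup.of 1)⁻¹

theorem matTop_foxDeriv_wordV (i : Fin 2) :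
    MatTop (Phi ρ (foxDeriv i wordV)) (-1) (topV ρ i) := by
  have h : expSum (FreeGroup.of (1 : Fin 2))⁻¹ = -1 := by rw [expSum_inv, expSum_of]
  rw [foxDeriv_wordV, topV]
  split_ifs
  · exact matTop_Phi_of_eq ρ h
  · rw [map_neg]
    exact (matTop_Phi_of_eq ρ h).neg

theorem matTop_geomSum_of_zero {g : FreeGroup (Fin 2)} (hg : expSum g = 0) (n : ℕ) :
    MatTop (Phi ρ (∑ l ∈ Finset.range n, ι g ^ l)) 0 (geomMat ρ n g) := by
  rw [Phi_geomSum]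
  exact (matTop_Phi_of_eq ρ hg).geomSum_of_zero n

theorem matTop_geomSum_of_pos {g : FreeGroup (Fin 2)} {d : ℤ} (hg : expSum g = d) (hd : 0 < d)
    (n : ℕ) :
    MatTop (Phi ρ (∑ l ∈ Finset.range (n + 1), ι g ^ l)) (d * n) (repMat ρ (g ^ n)) := by
  rw [Phi_geomSum, map_pow]
  exact (matTop_Phi_of_eq ρ hg).geomSum_of_pos hd n

theorem matTop_foxDeriv_pow_wordU (i : Fin 2) (m : ℕ) :
    MatTop (Phi ρ (foxDeriv i (wordU ^ m))) 0 (geomMat ρ m wordU * topU ρ i) := by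
  rw [foxDeriv_pow, map_mul]
  exact (matTop_geomSum_of_zero ρ expSum_wordU m).mul (matTop_foxDeriv_wordU ρ i)

theorem matTop_foxDeriv_pow_wordV (i : Fin 2) (m : ℕ) :
    MatTop (Phi ρ (foxDeriv i (wordV ^ m))) (-1) (geomMat ρ m wordV * topV ρ i) := by
  rw [foxDeriv_pow, map_mul]
  exact (matTop_geomSum_of_zero ρ expSum_wordV m).mul (matTop_foxDeriv_wordV ρ i)

/-- The derivative of `V^m` begins in degree `-1`, so only that of `U^m` contributes. -/
theorem matTop_foxDeriv_word_even (i : Fin 2) (m : ℕ) :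
    MatTop (Phi ρ (foxDeriv i (word (2 * m)))) 0 (geomMat ρ m wordU * topU ρ i) := by
  have hU : expSum (wordU ^ m) = 0 := by simp [expSum_pow, expSum_wordU]
  rw [word_even, foxDeriv_mul, map_add, map_mul]
  have h := ((matTop_Phi_of_eq ρ hU).mul (matTop_foxDeriv_pow_wordV ρ i m)).lower
    (e := 0) (by norm_num)
  simpa using (matTop_foxDeriv_pow_wordU ρ i m).add h

/-- Leading coefficient of `Φ(∂w/∂xᵢ)` in degree `1`, for odd `k`. -/
def topOdd (m : ℕ) (i : Fin 2) : Matrix (Fin 2) (Fin 2) R :=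
  (if i = 0 then repMat ρ (wordU ^ m * FreeGroup.of 1) else 0) +
    repMat ρ (wordU ^ m * (FreeGroup.of 1 * FreeGroup.of 0)) * (geomMat ρ m wordV * topV ρ i)

/-- The middle factor `ba` raises the `V^m` part to degree `2 - 1 = 1`, above the `U^m` part;
`∂(ba)` reaches degree 1 only for the generator `a`. -/
theorem matTop_foxDeriv_word_odd (i : Fin 2) (m : ℕ) :
    MatTop (Phi ρ (foxDeriv i (word (2 * m + 1)))) 1 (topOdd ρ m i) := by
  have hU : expSum (wordU ^ m) = 0 := by simp [expSum_pow, expSum_wordU]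
  have hUba : expSum (wordU ^ m * (FreeGroup.of 1 * FreeGroup.of 0)) = 2 := by
    simp [expSum_mul, hU, expSum_of]
  have hba : MatTop (Phi ρ (ι (wordU ^ m) * foxDeriv i (FreeGroup.of 1 * FreeGroup.of 0))) 1
      (if i = 0 then repMat ρ (wordU ^ m * FreeGroup.of 1) else 0) := by
    rw [foxDeriv_mul, foxDeriv_of, foxDeriv_of]
    fin_cases i
    · have h : expSum (wordU ^ m * FreeGroup.of 1) = 1 := by simp [expSum_mul, hU, expSum_of]
      simpa using matTop_Phi_of_eq ρ h
    · simpa using (matTop_Phi_of_eq ρ hU).lower (e := 1) one_pos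
  rw [word_odd, foxDeriv_mul, foxDeriv_mul, map_add, map_add, topOdd,
    map_mul _ (ι _) (foxDeriv i (wordV ^ m))]
  have h1 := (matTop_foxDeriv_pow_wordU ρ i m).lower (e := 1) one_pos
  have h2 := (matTop_Phi_of_eq ρ hUba).mul (matTop_foxDeriv_pow_wordV ρ i m)
  simpa using (h1.add hba).add h2

theorem foxDeriv_neg_pow (i : Fin 2) (g : FreeGroup (Fin 2)) (p : ℕ) :
    foxDeriv i (g ^ (-(p : ℤ))) =
      -(ι (g ^ (-(p : ℤ))) * (∑ l ∈ Finset.range p, ι g ^ l)) * foxDeriv i g := by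
  rw [zpow_neg, zpow_natCast, foxDeriv_inv, foxDeriv_pow, neg_mul, mul_assoc]

end TopTerms

/-! ### The top term of the determinant of each derivative of the relator. -/

section Relator

variable {R : Type*} [CommRing R] (ρ : FreeGroup (Fin 2) →* SL(2, R))

local notation "ι" => MonoidAlgebra.of ℤ (FreeGroup (Fin 2))

/-- The conjugate `w^q a w^{-q}`. -/
def conjA (k : ℕ) (q : ℤ) : FreeGroup (Fin 2) :=
  word k ^ q * FreeGroup.of 0 * word k ^ (-q)

theorem expSum_conjA (k : ℕ) (q : ℤ) : expSum (conjA k q) = 1 := by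
  simp [conjA, expSum_mul, expSum_inv, expSum_zpow, expSum_of]

theorem expSum_relator (k : ℕ) (q : ℤ) : expSum (relator k q) = 0 := by
  simp [relator, expSum_mul, expSum_inv, expSum_zpow, expSum_of]

theorem relator_eq (k : ℕ) (q : ℤ) : relator k q = conjA k q * (FreeGroup.of 1)⁻¹ := rfl

theorem matTop_one_sub_conjA (k : ℕ) (q : ℤ) :
    MatTop (Phi ρ (1 - ι (conjA k q))) 1 (-repMat ρ (conjA k q)) := by
  rw [map_sub, map_one]
  simpa using (MatTop.one.lower one_pos).sub (matTop_Phi_of_eq ρ (expSum_conjA k q))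

theorem foxDeriv_relator_zero (k : ℕ) (q : ℤ) :
    foxDeriv 0 (relator k q) =
      (1 - ι (conjA k q)) * foxDeriv 0 (word k ^ q) + ι (word k ^ q) := by
  rw [foxDeriv_relator, conjA]
  simp

theorem foxDeriv_relator_one (k : ℕ) (q : ℤ) :
    foxDeriv 1 (relator k q) =
      (1 - ι (conjA k q)) * foxDeriv 1 (word k ^ q) - ι (relator k q) := by
  rw [foxDeriv_relator, conjA]
  simp [sub_eq_add_neg]

/-- In degree `1`, only `-w^q a w^{-q} ∂(w^q)/∂xᵢ` contributes when `w` has exponent sum `0`. -/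
theorem matTop_foxDeriv_relator_of_zero {k : ℕ} (q : ℤ) (hk : expSum (word k) = 0) (i : Fin 2)
    {N : Matrix (Fin 2) (Fin 2) R} (hN : MatTop (Phi ρ (foxDeriv i (word k ^ q))) 0 N) :
    MatTop (Phi ρ (foxDeriv i (relator k q))) 1 (-repMat ρ (conjA k q) * N) := by
  have h1 := (matTop_one_sub_conjA ρ k q).mul hN
  rw [add_zero] at h1
  fin_cases i
  · have h2 : expSum (word k ^ q) = 0 := by simp [expSum_zpow, hk]
    have h3 := h1.add ((matTop_Phi_of_eq ρ h2).lower one_pos)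
    rw [add_zero] at h3
    change MatTop (Phi ρ (foxDeriv 0 (relator k q))) _ _
    rw [foxDeriv_relator_zero, map_add, map_mul]
    exact h3
  · have h3 := h1.sub ((matTop_Phi_of_eq ρ (expSum_relator k q)).lower one_pos)
    rw [sub_zero] at h3
    change MatTop (Phi ρ (foxDeriv 1 (relator k q))) _ _
    rw [foxDeriv_relator_one, map_sub, map_mul]
    exact h3

theorem matTop_foxDeriv_zpow_word_even (i : Fin 2) (m : ℕ) (q : ℤ) :
    ∃ c : Matrix (Fin 2) (Fin 2) R, c.det = 1 ∧
      MatTop (Phi ρ (foxDeriv i (word (2 * m) ^ q))) 0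
        (c * geomMat ρ q.natAbs (word (2 * m)) * (geomMat ρ m wordU * topU ρ i)) := by
  have hS := matTop_geomSum_of_zero ρ (expSum_word_even m) q.natAbs
  have hD := matTop_foxDeriv_word_even ρ i m
  obtain h | h := Int.natAbs_eq q
  · refine ⟨1, Matrix.det_one, ?_⟩
    generalize q.natAbs = p at *
    rw [h, zpow_natCast, foxDeriv_pow, map_mul]
    simpa using hS.mul hD
  · generalize q.natAbs = p at *
    refine ⟨-repMat ρ (word (2 * m) ^ q), by simp [Matrix.det_neg, det_repMat], ?_⟩
    have hw : expSum (word (2 * m) ^ q) = 0 := by simp [expSum_zpow, expSum_word_even]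
    have := ((matTop_Phi_of_eq ρ hw).mul hS).neg.mul hD
    rw [h] at this ⊢
    rw [foxDeriv_neg_pow, map_mul, map_neg, map_mul]
    simpa using this

theorem det_topU (i : Fin 2) : (topU ρ i).det = 1 := by
  rw [topU]
  split_ifs
  · simp [Matrix.det_neg, det_repMat]
  · simp

theorem hasTop_det_foxDeriv_relator_even (i : Fin 2) (m : ℕ) (q : ℤ) :
    HasTop (Phi ρ (foxDeriv i (relator (2 * m) q))).det 2
      ((geomMat ρ q.natAbs (word (2 * m))).det * (geomMat ρ m wordU).det) := by
  obtain ⟨c, hc, h⟩ := matTop_foxDeriv_zpow_word_even ρ i m q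
  have := (matTop_foxDeriv_relator_of_zero ρ q (expSum_word_even m) i h).det
  simpa [Matrix.det_neg, det_repMat, hc, det_topU] using this

theorem geomMat_succ (n : ℕ) (g : FreeGroup (Fin 2)) :
    geomMat ρ (n + 1) g = geomMat ρ n g + repMat ρ (g ^ n) := by
  rw [geomMat, Finset.sum_range_succ, map_pow, geomMat]

theorem geomMat_succ' (n : ℕ) (g : FreeGroup (Fin 2)) :
    geomMat ρ (n + 1) g = repMat ρ g * geomMat ρ n g + 1 := by
  rw [geomMat, geom_sum_succ, geomMat]

theorem geomMat_mul (n : ℕ) (g : FreeGroup (Fin 2)) :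
    geomMat ρ n g * (repMat ρ g - 1) = repMat ρ (g ^ n) - 1 := by
  rw [geomMat, geom_sum_mul, map_pow]

theorem topOdd_zero (m : ℕ) :
    topOdd ρ m 0 = repMat ρ (wordU ^ m * (FreeGroup.of 1 * FreeGroup.of 0)) *
      (repMat ρ (FreeGroup.of 0)⁻¹ + geomMat ρ m wordV * repMat ρ (FreeGroup.of 1)⁻¹) := by
  rw [mul_add, ← map_mul, ← mul_assoc (wordU ^ m) (FreeGroup.of 1), mul_inv_cancel_right]
  simp [topOdd, topV, mul_assoc]

theorem topOdd_one (m : ℕ) :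
    topOdd ρ m 1 = -(repMat ρ (wordU ^ m * (FreeGroup.of 1 * FreeGroup.of 0)) *
      (geomMat ρ m wordV * repMat ρ (FreeGroup.of 1)⁻¹)) := by
  simp [topOdd, topV, mul_assoc]

/-- From `a⁻¹ = V⁻¹b⁻¹` and `S_{m+1}(V) = V S_m(V) + 1`. It serves `q < 0`, column `a`. -/
theorem repMat_mul_geomMat_add (m : ℕ) :
    repMat ρ (FreeGroup.of 0)⁻¹ + geomMat ρ m wordV * repMat ρ (FreeGroup.of 1)⁻¹ =
      repMat ρ wordV⁻¹ * geomMat ρ (m + 1) wordV * repMat ρ (FreeGroup.of 1)⁻¹ := by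
  rw [geomMat_succ', mul_add, ← mul_assoc, ← map_mul, inv_mul_cancel, map_one, one_mul, mul_one,
    add_mul, ← map_mul, add_comm]
  simp [wordV]

/-- Telescoping, since `b⁻¹ - a⁻¹ = (V - 1)a⁻¹`. For `q > 0`, column `a`, the subtracted term comes
from the summand `w^q` of the derivative. -/
theorem repMat_mul_geomMat_sub (m : ℕ) :
    repMat ρ (FreeGroup.of 0)⁻¹ + geomMat ρ m wordV * repMat ρ (FreeGroup.of 1)⁻¹
        - repMat ρ (wordV ^ m * (FreeGroup.of 0)⁻¹) =
      geomMat ρ m wordV * repMat ρ (FreeGroup.of 0)⁻¹ := by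
  have h : (repMat ρ wordV - 1) * repMat ρ (FreeGroup.of 0)⁻¹ =
      repMat ρ (FreeGroup.of 1)⁻¹ - repMat ρ (FreeGroup.of 0)⁻¹ := by
    rw [sub_mul, one_mul, ← map_mul, wordV, mul_inv_cancel_right]
  have h' : geomMat ρ m wordV * ((repMat ρ wordV - 1) * repMat ρ (FreeGroup.of 0)⁻¹) =
      (repMat ρ (wordV ^ m) - 1) * repMat ρ (FreeGroup.of 0)⁻¹ := by
    rw [← mul_assoc, geomMat_mul]
  rw [h, mul_sub, sub_mul, one_mul, ← map_mul, sub_eq_sub_iff_add_eq_add] at h'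
  rw [sub_eq_iff_eq_add, add_comm, h', add_comm]

theorem hasTop_det_foxDeriv_relator_odd_neg (i : Fin 2) (m p : ℕ) :
    HasTop (Phi ρ (foxDeriv i (relator (2 * m + 1) (-((p + 1 : ℕ) : ℤ))))).det 0
      (geomMat ρ (m + 1) wordV).det := by
  set q : ℤ := -((p + 1 : ℕ) : ℤ) with hq
  set w := word (2 * m + 1) with hw
  have hwq : expSum (w ^ q) = 2 * q := by
    rw [expSum_zpow, hw, expSum_word_odd, mul_comm]
  have hH := ((matTop_Phi_of_eq ρ hwq).mul (matTop_geomSum_of_pos ρ (expSum_word_odd m)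
    two_pos p)).neg
  have hD := hH.mul (matTop_foxDeriv_word_odd ρ i m)
  have hX := (matTop_one_sub_conjA ρ (2 * m + 1) q).mul hD
  rw [← map_mul, ← map_neg, ← map_mul, ← foxDeriv_neg_pow, ← map_mul, ← map_mul] at hX
  have hdeg : 1 + (2 * q + 2 * (p : ℤ) + 1) = 0 := by rw [hq]; push_cast; ring
  rw [hdeg] at hX
  -- As `q = -(p + 1)`, the powers of `w` collapse to `w⁻¹`, which cancels `U^m ba` and leaves
  -- `V^{-m}`.
  have hG : conjA (2 * m + 1) q * (w ^ q * w ^ p) *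
      (wordU ^ m * (FreeGroup.of 1 * FreeGroup.of 0)) = conjA (2 * m + 1) q * (wordV ^ m)⁻¹ := by
    have h1 : w ^ q * w ^ p = w⁻¹ := by
      rw [← zpow_natCast, ← zpow_add, ← zpow_neg_one]
      congr 1
      rw [hq]; push_cast; ring
    rw [h1, hw, word_odd]
    group
  have hdet : ∀ N : Matrix (Fin 2) (Fin 2) R,
      MatTop (Phi ρ (foxDeriv i (relator (2 * m + 1) q))) 0 N →
      N.det = (geomMat ρ (m + 1) wordV).det →
      HasTop (Phi ρ (foxDeriv i (relator (2 * m + 1) q))).det 0 (geomMat ρ (m + 1) wordV).det := fun N hN hd => by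
    simpa [hd] using hN.det
  fin_cases i
  · change MatTop (Phi ρ ((1 - ι (conjA (2 * m + 1) q)) * foxDeriv 0 (w ^ q))) 0
      (-repMat ρ (conjA (2 * m + 1) q) * (-_ * topOdd ρ m 0)) at hX
    refine hdet _ (by
      change MatTop (Phi ρ (foxDeriv 0 (relator (2 * m + 1) q))) _ _
      rw [foxDeriv_relator_zero, map_add]
      exact hX.add ((matTop_Phi_of_eq ρ hwq).lower (by rw [hq]; push_cast; linarith))) ?_
    rw [topOdd_zero, repMat_mul_geomMat_add]
    simp [det_repMat]
  · change MatTop (Phi ρ ((1 - ι (conjA (2 * m + 1) q)) * foxDeriv 1 (w ^ q))) 0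
      (-repMat ρ (conjA (2 * m + 1) q) * (-_ * topOdd ρ m 1)) at hX
    refine hdet _ (by
      change MatTop (Phi ρ (foxDeriv 1 (relator (2 * m + 1) q))) _ _
      rw [foxDeriv_relator_one, map_sub]
      exact hX.sub (matTop_Phi_of_eq ρ (expSum_relator _ q))) ?_
    -- In column `b` the summand `-r` also has degree 0; it supplies the term `V^m` that turns
    -- `S_m(V)` into `S_{m+1}(V)`.
    have : -repMat ρ (conjA (2 * m + 1) q) * (-repMat ρ (w ^ q * word (2 * m + 1) ^ p) *
        topOdd ρ m 1) - repMat ρ (relator (2 * m + 1) q) =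
        -(repMat ρ (conjA (2 * m + 1) q * (wordV ^ m)⁻¹) * geomMat ρ (m + 1) wordV *
          repMat ρ (FreeGroup.of 1)⁻¹) := by
      rw [← hw, topOdd_one, geomMat_succ, relator_eq, mul_add, add_mul, ← map_mul _ _ (wordV ^ m),
        inv_mul_cancel_right, ← map_mul, ← hG]
      simp only [map_mul, mul_assoc, neg_mul, mul_neg, neg_neg]
      abel
    rw [this]
    simp [Matrix.det_neg, det_repMat]

theorem hasTop_det_foxDeriv_relator_odd_pos (i : Fin 2) (m p : ℕ) :
    HasTop (Phi ρ (foxDeriv i (relator (2 * m + 1) ((p + 1 : ℕ) : ℤ)))).det (4 * (p + 1))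
      (geomMat ρ m wordV).det := by
  set q : ℤ := ((p + 1 : ℕ) : ℤ) with hq
  set w := word (2 * m + 1) with hw
  have hwq : expSum (w ^ q) = 2 * ((p : ℤ) + 1) := by
    rw [expSum_zpow, hw, expSum_word_odd, mul_comm, hq]; push_cast; ring
  have hD := (matTop_geomSum_of_pos ρ (expSum_word_odd m) two_pos p).mul
    (matTop_foxDeriv_word_odd ρ i m)
  have hX := (matTop_one_sub_conjA ρ (2 * m + 1) q).mul hD
  rw [← map_mul, ← foxDeriv_pow, ← map_mul, ← zpow_natCast, ← hq] at hX
  have hdeg : 1 + (2 * (p : ℤ) + 1) = 2 * ((p : ℤ) + 1) := by ring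
  rw [hdeg] at hX
  have hG : conjA (2 * m + 1) q * w ^ p *
      (wordU ^ m * (FreeGroup.of 1 * FreeGroup.of 0)) =
      w ^ q * FreeGroup.of 0 * (wordV ^ m)⁻¹ := by
    have h1 : w ^ (-q) * w ^ p = w⁻¹ := by
      rw [← zpow_natCast, ← zpow_add, ← zpow_neg_one]
      congr 1
      rw [hq]; push_cast; ring
    rw [conjA, mul_assoc _ _ (w ^ p), h1, mul_assoc]
    congr 1
    rw [hw, word_odd]
    group
  have hdet : ∀ N : Matrix (Fin 2) (Fin 2) R,
      MatTop (Phi ρ (foxDeriv i (relator (2 * m + 1) q))) (2 * ((p : ℤ) + 1)) N →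
      N.det = (geomMat ρ m wordV).det → HasTop (Phi ρ (foxDeriv i (relator (2 * m + 1) q))).det
      (4 * (p + 1)) (geomMat ρ m wordV).det := fun N hN hd => by
    have := hN.det
    rw [hd] at this
    convert this using 1
    ring
  fin_cases i
  · change MatTop (Phi ρ ((1 - ι (conjA (2 * m + 1) q)) * foxDeriv 0 (w ^ q))) _
      (-repMat ρ (conjA (2 * m + 1) q) * (_ * topOdd ρ m 0)) at hX
    refine hdet _ (by
      change MatTop (Phi ρ (foxDeriv 0 (relator (2 * m + 1) q))) _ _
      rw [foxDeriv_relator_zero, map_add]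
      exact hX.add (matTop_Phi_of_eq ρ hwq)) ?_
    have : -repMat ρ (conjA (2 * m + 1) q) * (repMat ρ (w ^ p) * topOdd ρ m 0) +
        repMat ρ (w ^ q) = -(repMat ρ (w ^ q * FreeGroup.of 0 * (wordV ^ m)⁻¹) *
          (geomMat ρ m wordV * repMat ρ (FreeGroup.of 0)⁻¹)) := by
      -- The summand `w^q` has the same degree `2q` as the main term, so it is rewritten with the
      -- same left factor.
      have h2 : w ^ q = w ^ q * FreeGroup.of 0 * (wordV ^ m)⁻¹ *
        (wordV ^ m * (FreeGroup.of 0)⁻¹) := by group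
      rw [topOdd_zero, ← repMat_mul_geomMat_sub, mul_sub, ← map_mul, ← h2, ← hG]
      simp only [map_mul, mul_assoc, neg_mul, neg_sub]
      abel
    rw [this]
    simp [Matrix.det_neg, det_repMat]
  · change MatTop (Phi ρ ((1 - ι (conjA (2 * m + 1) q)) * foxDeriv 1 (w ^ q))) _
      (-repMat ρ (conjA (2 * m + 1) q) * (_ * topOdd ρ m 1)) at hX
    refine hdet _ (by
      change MatTop (Phi ρ (foxDeriv 1 (relator (2 * m + 1) q))) _ _
      rw [foxDeriv_relator_one, map_sub]
      exact hX.sub ((matTop_Phi_of_eq ρ (expSum_relator _ q)).lower (by linarith))) ?_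
    rw [topOdd_one]
    simp [det_repMat]

/-- Here `w = ba`. In column `a` the summand `w^q` cancels exactly against a term of the product,
leaving `w^p b` on top; in column `b` one has `∂w = 1`. Either way the top coefficient is plus or
minus a group element. -/
theorem hasTop_det_foxDeriv_relator_one_pos (i : Fin 2) (p : ℕ) :
    HasTop (Phi ρ (foxDeriv i (relator 1 ((p + 1 : ℕ) : ℤ)))).det (4 * p + 2) 1 := by
  set q : ℤ := ((p + 1 : ℕ) : ℤ) with hq
  set w := word 1 with hw
  have hwba : w = FreeGroup.of 1 * FreeGroup.of 0 := by simpa using word_odd 0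
  have hexp : expSum w = 2 := expSum_word_odd 0
  have hdet : ∀ N : Matrix (Fin 2) (Fin 2) R,
      MatTop (Phi ρ (foxDeriv i (relator 1 q))) (2 * p + 1) N → N.det = 1 →
      HasTop (Phi ρ (foxDeriv i (relator 1 q))).det (4 * p + 2) 1 := fun N hN hd => by
    have := hN.det
    rw [hd] at this
    convert this using 1
    ring
  fin_cases i
  · have hDw : foxDeriv 0 w = ι (FreeGroup.of 1) := by
      rw [hwba, foxDeriv_mul, foxDeriv_of, foxDeriv_of]
      simp
    have hX : conjA 1 q * (w ^ p * FreeGroup.of 1) = w ^ q := by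
      have h1 : w ^ (-q) * w ^ p = w⁻¹ := by
        rw [← zpow_natCast, ← zpow_add, ← zpow_neg_one]
        congr 1
        rw [hq]; push_cast; ring
      have h2 : FreeGroup.of 0 * (w⁻¹ * FreeGroup.of 1) = 1 := by
        rw [hwba]
        group
      rw [conjA, ← hw, mul_assoc, ← mul_assoc _ (w ^ p), h1, mul_assoc, h2, mul_one]
    have hD : foxDeriv 0 (relator 1 q) =
        (1 - ι (conjA 1 q)) * ((∑ l ∈ Finset.range p, ι w ^ l) * ι (FreeGroup.of 1)) +
          ι (w ^ p * FreeGroup.of 1) := by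
      have h2 : foxDeriv 0 (w ^ q) = (∑ l ∈ Finset.range p, ι w ^ l) * ι (FreeGroup.of 1) +
          ι (w ^ p * FreeGroup.of 1) := by
        rw [hq, zpow_natCast, foxDeriv_pow, Finset.sum_range_succ, hDw, add_mul, map_mul, map_pow]
      rw [foxDeriv_relator_zero, h2, mul_add, sub_mul _ _ (ι (w ^ p * _)), one_mul, ← map_mul, hX]
      abel
    -- The degree is at most `2p - 2` (the sum is empty for `p = 0`); the bound one higher makes the
    -- product vanish in degree `2p + 1`.
    have hS : MatTop (Phi ρ (∑ l ∈ Finset.range p, ι w ^ l)) (2 * p - 1) 0 := by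
      cases p with
      | zero => simpa using MatTop.zero (R := R) _
      | succ p =>
        exact (matTop_geomSum_of_pos ρ hexp two_pos p).lower (by push_cast; linarith)
    have hlow := (matTop_one_sub_conjA ρ 1 q).mul
      (hS.mul (matTop_Phi_of_eq ρ (expSum_of 1)))
    have hw1 : expSum (w ^ p * FreeGroup.of 1) = 2 * p + 1 := by
      rw [expSum_mul, expSum_pow, hexp, expSum_of]; ring
    have hdeg : 1 + (2 * (p : ℤ) - 1 + 1) = 2 * p + 1 := by ring
    rw [hdeg] at hlow
    refine hdet _ (by
      change MatTop (Phi ρ (foxDeriv 0 (relator 1 q))) _ _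
      rw [hD, map_add, map_mul, map_mul]
      exact hlow.add (matTop_Phi_of_eq ρ hw1)) ?_
    simp [det_repMat]
  · have hDw : foxDeriv 1 w = 1 := by
      rw [hwba, foxDeriv_mul, foxDeriv_of, foxDeriv_of]
      simp
    have hX := (matTop_one_sub_conjA ρ 1 q).mul (matTop_geomSum_of_pos ρ hexp two_pos p)
    rw [add_comm 1] at hX
    have hX' := hX.sub ((matTop_Phi_of_eq ρ (expSum_relator 1 q)).lower (by positivity))
    refine hdet _ (by
      change MatTop (Phi ρ (foxDeriv 1 (relator 1 q))) _ _
      rw [foxDeriv_relator_one, map_sub, hq, zpow_natCast, foxDeriv_pow, hDw, mul_one, map_mul,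
        ← hq]
      exact hX') ?_
    simp [Matrix.det_neg, det_repMat]

end Relator

/-! ### The leading coefficient in closed form, and change of rings. -/

section LeadCoeff

/-- The degree of `det Φ(∂r/∂xᵢ)` in `t`. -/
def topDegree (k : ℕ) (q : ℤ) : ℤ :=
  if Even k then 2 else if q < 0 then 0 else if k = 1 then 4 * q - 2 else 4 * q

/-- The leading coefficient of `det Φ(∂r/∂xᵢ)` as a polynomial in `t`. -/
def leadCoeff {R : Type*} [CommRing R] (k : ℕ) (q : ℤ) (ρ : FreeGroup (Fin 2) →* SL(2, R)) : R :=
  if Even k then (geomMat ρ q.natAbs (word k)).det * (geomMat ρ (k / 2) wordU).det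
  else if q < 0 then (geomMat ρ (k / 2 + 1) wordV).det
  else if k = 1 then 1 else (geomMat ρ (k / 2) wordV).det

theorem hasTop_det_foxDeriv_relator {R : Type*} [CommRing R] (ρ : FreeGroup (Fin 2) →* SL(2, R))
    (i : Fin 2) (k : ℕ) {q : ℤ} (hq : q ≠ 0) :
    HasTop (Phi ρ (foxDeriv i (relator k q))).det (topDegree k q) (leadCoeff k q ρ) := by
  obtain ⟨m, rfl | rfl⟩ := k.even_or_odd'
  · simpa [topDegree, leadCoeff] using hasTop_det_foxDeriv_relator_even ρ i m q
  have hodd : ¬ Even (2 * m + 1) := by simp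
  have hm : (2 * m + 1) / 2 = m := by omega
  simp only [topDegree, leadCoeff, if_neg hodd, hm]
  split_ifs with hneg h1
  · obtain ⟨p, rfl⟩ : ∃ p : ℕ, q = -((p + 1 : ℕ) : ℤ) := ⟨(-q - 1).toNat, by omega⟩
    exact hasTop_det_foxDeriv_relator_odd_neg ρ i m p
  · obtain ⟨p, rfl⟩ : ∃ p : ℕ, q = ((p + 1 : ℕ) : ℤ) := ⟨(q - 1).toNat, by omega⟩
    convert hasTop_det_foxDeriv_relator_one_pos ρ i p using 1
    · rw [h1]
    · push_cast; ring
  · obtain ⟨p, rfl⟩ : ∃ p : ℕ, q = ((p + 1 : ℕ) : ℤ) := ⟨(q - 1).toNat, by omega⟩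
    convert hasTop_det_foxDeriv_relator_odd_pos ρ i m p using 1
    push_cast; ring

theorem hasTop_det_one_sub {R : Type*} [CommRing R] (ρ : FreeGroup (Fin 2) →* SL(2, R))
    (j : Fin 2) :
    HasTop (Phi ρ (1 - MonoidAlgebra.of ℤ _ (FreeGroup.of j))).det 2 1 := by
  rw [map_sub, map_one]
  have := ((MatTop.one.lower one_pos).sub (matTop_Phi_of_eq ρ (expSum_of j))).det
  simpa [Matrix.det_neg, det_repMat] using this

theorem hasTopTerm_twistedAlexander {R : Type*} [CommRing R] [IsDomain R]
    (ρ : FreeGroup (Fin 2) →* SL(2, R)) (j : Fin 2) (k : ℕ) {q : ℤ} (hq : q ≠ 0) :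
    HasTopTerm (twistedAlexander (relator k q) ρ j) (topDegree k q - 2) (leadCoeff k q ρ) := by
  have hP := hasTop_det_foxDeriv_relator ρ (1 - j) k hq
  have hQ := hasTop_det_one_sub ρ j
  refine ⟨_, _, 2, rfl, hQ.1, hQ.2, ?_⟩
  rw [sub_add_cancel]
  exact hP

variable {R S : Type*} [CommRing R] [CommRing S] (f : R →+* S)

theorem map_det_geomMat (ρ : FreeGroup (Fin 2) →* SL(2, R)) (n : ℕ) (g : FreeGroup (Fin 2)) :
    f (geomMat ρ n g).det =
      (geomMat ((Matrix.SpecialLinearGroup.map f).comp ρ) n g).det := by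
  have h : f.mapMatrix (repMat ρ g) = repMat ((Matrix.SpecialLinearGroup.map f).comp ρ) g := rfl
  rw [RingHom.map_det, geomMat, map_sum, geomMat]
  simp only [map_pow, h]

theorem map_leadCoeff (k : ℕ) (q : ℤ) (ρ : FreeGroup (Fin 2) →* SL(2, R)) :
    f (leadCoeff k q ρ) = leadCoeff k q ((Matrix.SpecialLinearGroup.map f).comp ρ) := by
  unfold leadCoeff
  split_ifs <;> simp only [map_mul, map_one, map_det_geomMat]

theorem coe_matA (s : Rˣ) :
    (matA s : Matrix (Fin 2) (Fin 2) R) = !![(s : R), 1; 0, ((s⁻¹ : Rˣ) : R)] :=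
  rfl

theorem coe_matB (s : Rˣ) (y : R) :
    (matB s y : Matrix (Fin 2) (Fin 2) R) = !![(s : R), 0; -y, ((s⁻¹ : Rˣ) : R)] :=
  rfl

theorem map_comp_rileyRep (s : Rˣ) (y : R) :
    (Matrix.SpecialLinearGroup.map f).comp (rileyRep s y) =
      rileyRep (Units.map (f : R →* S) s) (f y) := by
  ext j : 1
  fin_cases j <;> ext i l <;> fin_cases i <;> fin_cases l <;>
    simp [rileyRep, coe_matA, coe_matB]

end LeadCoeff

/-! ### Determinants of geometric sums in `SL₂`. -/

section Degree

variable {R : Type*} [CommRing R]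

theorem trace_pow_add_two (M : Matrix (Fin 2) (Fin 2) R) (hM : M.det = 1) (n : ℕ) :
    (M ^ (n + 2)).trace = M.trace * (M ^ (n + 1)).trace - (M ^ n).trace := by
  -- Cayley–Hamilton.
  have h : M ^ 2 = M.trace • M - 1 := by
    rw [Matrix.det_fin_two] at hM
    ext i j
    fin_cases i <;> fin_cases j <;>
      simp [pow_two, Matrix.mul_apply, Matrix.trace_fin_two] <;>
      first | ring1 | linear_combination -hM
  rw [pow_add, h, mul_sub, mul_one, Matrix.mul_smul, ← pow_succ, Matrix.trace_sub,
    Matrix.trace_smul, smul_eq_mul]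

/-- Apply `det (N + 1) = det N + tr (N + 1) - 1` to `N = M S_n`, whose determinant is that of `S_n`.
-/
theorem det_geomSum_succ (M : Matrix (Fin 2) (Fin 2) R) (hM : M.det = 1) (n : ℕ) :
    (∑ l ∈ Finset.range (n + 1), M ^ l).det =
      (∑ l ∈ Finset.range n, M ^ l).det + (∑ l ∈ Finset.range (n + 1), M ^ l).trace - 1 := by
  have h : ∀ N : Matrix (Fin 2) (Fin 2) R, (N + 1).det = N.det + (N + 1).trace - 1 := fun N => by
    simp [Matrix.det_fin_two, Matrix.trace_fin_two]
    ring
  rw [geom_sum_succ, h, Matrix.det_mul, hM, one_mul]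

/-- If `det M = 1` and `tr M` has positive degree, then `1 + M + ⋯ + M^n` has determinant of degree
`n deg (tr M)`. -/
theorem hasTop_det_geomSum {M : Matrix (Fin 2) (Fin 2) R[T;T⁻¹]} (hM : M.det = 1) {d : ℤ} {c : R}
    (hd : 0 < d) (htr : HasTop M.trace d c) (n : ℕ) :
    HasTop (∑ l ∈ Finset.range (n + 1), M ^ l).det (d * n) (c ^ n) := by
  -- The recursions for traces and determinants are run together. Two coefficients are left
  -- unspecified because both traces equal 2 at `n = 0`, and only their degree bounds are needed.
  suffices h : HasTop (M ^ (n + 1)).trace (d * (n + 1 : ℕ)) (c ^ (n + 1)) ∧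
      (∃ c', HasTop (M ^ n).trace (d * n) c') ∧
      (∃ c', HasTop (∑ l ∈ Finset.range (n + 1), M ^ l).trace (d * n) c') ∧
      HasTop (∑ l ∈ Finset.range (n + 1), M ^ l).det (d * n) (c ^ n) from h.2.2.2
  induction n with
  | zero =>
    have h2 : HasTop (2 : R[T;T⁻¹]) 0 2 := by
      have := HasTop.C (2 : R)
      rwa [map_ofNat] at this
    refine ⟨by simpa using htr, ⟨2, ?_⟩, ⟨2, ?_⟩, ?_⟩
    · simpa using h2
    · simpa using h2
    · simpa using HasTop.one (R := R)
  | succ n ih =>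
    obtain ⟨h1, ⟨c₀, h0⟩, ⟨cE, hE⟩, hD⟩ := ih
    have hlt : d * n < d * (n + 1 : ℕ) := by push_cast; nlinarith
    have hlt0 : 0 < d * (n + 1 : ℕ) := by positivity
    have hE' : HasTop (∑ l ∈ Finset.range (n + 1 + 1), M ^ l).trace (d * (n + 1 : ℕ))
        (c ^ (n + 1)) := by
      rw [Finset.sum_range_succ, Matrix.trace_add]
      simpa using (hE.lower hlt).add h1
    refine ⟨?_, ⟨_, h1⟩, ⟨_, hE'⟩, ?_⟩
    · rw [trace_pow_add_two M hM]
      have h2 := htr.mul h1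
      have hdeg : d + d * (n + 1 : ℕ) = d * (n + 1 + 1 : ℕ) := by push_cast; ring
      rw [hdeg] at h2
      have h3 := h2.sub (h0.lower (e := d * (n + 1 + 1 : ℕ)) (by push_cast; nlinarith))
      rwa [sub_zero, ← pow_succ'] at h3
    · rw [det_geomSum_succ M hM]
      have h3 := ((hD.lower hlt).add hE').sub (HasTop.one.lower hlt0)
      simpa using h3

/-! ### The Riley matrices graded by total degree. -/

variable (R) in
/-- The unit `T` of the Laurent polynomial ring. -/
noncomputable def unitT : R[T;T⁻¹]ˣ where
  val := LaurentPolynomial.T 1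
  inv := LaurentPolynomial.T (-1)
  val_inv := by rw [← LaurentPolynomial.T_add]; simp
  inv_val := by rw [← LaurentPolynomial.T_add]; simp

theorem coe_unitT_zpow (i : ℤ) :
    ((unitT R ^ i : R[T;T⁻¹]ˣ) : R[T;T⁻¹]) = LaurentPolynomial.T i := by
  obtain ⟨n, rfl | rfl⟩ := i.eq_nat_or_neg
  · rw [zpow_natCast, Units.val_pow_eq_pow_val]
    simp [unitT, LaurentPolynomial.T_pow]
  · rw [zpow_neg, zpow_natCast, ← inv_pow, Units.val_pow_eq_pow_val]
    simp [unitT, LaurentPolynomial.T_pow]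

theorem repMat_rileyRep_wordU (s : Rˣ) (y : R) :
    repMat (rileyRep s y) wordU = !![1, -(s : R); -y * ((s⁻¹ : Rˣ) : R), y + 1] := by
  have h : repMat (rileyRep s y) wordU =
      ((matB s y * (matA s)⁻¹ : SL(2, R)) : Matrix (Fin 2) (Fin 2) R) := by
    simp [repMat, rileyRep, wordU]
  rw [h, Matrix.SpecialLinearGroup.coe_mul, Matrix.SpecialLinearGroup.coe_inv, coe_matA, coe_matB,
    Matrix.adjugate_fin_two_of]
  ext i j
  fin_cases i <;> fin_cases j <;> simp [Matrix.mul_apply]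

theorem repMat_rileyRep_wordV (s : Rˣ) (y : R) :
    repMat (rileyRep s y) wordV = !![1, ((s⁻¹ : Rˣ) : R); y * s, y + 1] := by
  have h : repMat (rileyRep s y) wordV =
      (((matB s y)⁻¹ * matA s : SL(2, R)) : Matrix (Fin 2) (Fin 2) R) := by
    simp [repMat, rileyRep, wordV]
  rw [h, Matrix.SpecialLinearGroup.coe_mul, Matrix.SpecialLinearGroup.coe_inv, coe_matA, coe_matB,
    Matrix.adjugate_fin_two_of]
  ext i j
  fin_cases i <;> fin_cases j <;> simp [Matrix.mul_apply]

/-- The Riley representation with `s = T` and `y = x T`. -/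
noncomputable def gradedRep (x : R) : FreeGroup (Fin 2) →* SL(2, R[T;T⁻¹]) :=
  rileyRep (unitT R) (LaurentPolynomial.C x * LaurentPolynomial.T 1)

theorem hasTop_C_mul_T_add_one (x : R) :
    HasTop (LaurentPolynomial.C x * LaurentPolynomial.T 1 + 1) 1 x := by
  simpa using (HasTop.C_mul_T x 1).add (HasTop.one.lower one_pos)

theorem repMat_gradedRep_wordU (x : R) :
    repMat (gradedRep x) wordU = !![1, -LaurentPolynomial.T 1;
      -LaurentPolynomial.C x, LaurentPolynomial.C x * LaurentPolynomial.T 1 + 1] := by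
  have h : LaurentPolynomial.C x * LaurentPolynomial.T 1 * LaurentPolynomial.T (-1) =
      LaurentPolynomial.C x := by simp [LaurentPolynomial.mul_T_assoc]
  rw [gradedRep, repMat_rileyRep_wordU, neg_mul]
  simp [unitT, h]

theorem repMat_gradedRep_wordV (x : R) :
    repMat (gradedRep x) wordV = !![1, LaurentPolynomial.T (-1);
      LaurentPolynomial.C x * LaurentPolynomial.T 2,
      LaurentPolynomial.C x * LaurentPolynomial.T 1 + 1] := by
  have h : LaurentPolynomial.C x * LaurentPolynomial.T 1 * LaurentPolynomial.T 1 =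
      LaurentPolynomial.C x * LaurentPolynomial.T 2 := by simp [LaurentPolynomial.mul_T_assoc]
  rw [gradedRep, repMat_rileyRep_wordV]
  simp [unitT, h]

theorem hasTop_trace_wordU (x : R) : HasTop (repMat (gradedRep x) wordU).trace 1 x := by
  rw [repMat_gradedRep_wordU, Matrix.trace_fin_two]
  simpa using (HasTop.one.lower one_pos).add (hasTop_C_mul_T_add_one x)

theorem hasTop_trace_wordV (x : R) : HasTop (repMat (gradedRep x) wordV).trace 1 x := by
  rw [repMat_gradedRep_wordV, Matrix.trace_fin_two]
  simpa using (HasTop.one.lower one_pos).add (hasTop_C_mul_T_add_one x)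

theorem matTop_gradedRep_wordU (x : R) :
    MatTop (repMat (gradedRep x) wordU) 1 !![0, -1; 0, x] := by
  rw [repMat_gradedRep_wordU]
  intro i j
  fin_cases i <;> fin_cases j
  · exact HasTop.one.lower one_pos
  · exact (HasTop.T 1).neg
  · exact (HasTop.C x).neg.lower one_pos
  · exact hasTop_C_mul_T_add_one x

/-- Conjugation by `diag(1, T)` balances the degrees of the entries of `ρ(b⁻¹a)`. -/
theorem exists_matTop_gradedRep_wordV (x : R) :
    ∃ M, MatTop M 1 !![0, 0; x, x] ∧
      repMat (gradedRep x) wordV * !![1, 0; 0, LaurentPolynomial.T 1] =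
        !![1, 0; 0, LaurentPolynomial.T 1] * M := by
  -- The witness is `D⁻¹ρ(V)D` with `D = diag(1, T)`.
  refine ⟨!![1, 1; LaurentPolynomial.C x * LaurentPolynomial.T 1,
    LaurentPolynomial.C x * LaurentPolynomial.T 1 + 1], fun i j => ?_, ?_⟩
  · fin_cases i <;> fin_cases j
    · exact HasTop.one.lower one_pos
    · exact HasTop.one.lower one_pos
    · exact HasTop.C_mul_T x 1
    · exact hasTop_C_mul_T_add_one x
  · have h' : (LaurentPolynomial.T (-1) : R[T;T⁻¹]) * LaurentPolynomial.T 1 = 1 := by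
      rw [← LaurentPolynomial.T_add]; simp
    rw [repMat_gradedRep_wordV]
    ext1 i j
    fin_cases i <;> fin_cases j <;> simp [Matrix.mul_apply, h']

/-- After balancing `V`, both powers have entries of degree at most `m + 1`. Undoing the conjugation
multiplies the pairing of entry `(0, 1)` with entry `(1, 0)` by `T`, so it alone reaches degree `2(m
+ 1) + 1`, with coefficient `-x^m · x^(m+1)`. -/
theorem hasTop_trace_word_even (x : R) (m : ℕ) :
    HasTop (repMat (gradedRep x) (word (2 * (m + 1)))).trace (2 * (m + 1 : ℕ) + 1)
      (-x ^ (2 * m + 1)) := by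
  obtain ⟨M, hM, hconj⟩ := exists_matTop_gradedRep_wordV x
  set D : Matrix (Fin 2) (Fin 2) R[T;T⁻¹] := !![1, 0; 0, LaurentPolynomial.T 1] with hD
  set D' : Matrix (Fin 2) (Fin 2) R[T;T⁻¹] := !![1, 0; 0, LaurentPolynomial.T (-1)] with hD'
  have h' : (LaurentPolynomial.T 1 : R[T;T⁻¹]) * LaurentPolynomial.T (-1) = 1 := by
    rw [← LaurentPolynomial.T_add]; simp
  have hDD' : D * D' = 1 := by
    rw [hD, hD', Matrix.one_fin_two]
    simp [h']
  have hV : repMat (gradedRep x) wordV ^ (m + 1) = D * M ^ (m + 1) * D' := by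
    have h : SemiconjBy D M (repMat (gradedRep x) wordV) := hconj.symm
    rw [(h.pow_right (m + 1)).eq, mul_assoc, hDD', mul_one]
  have hNU : (!![0, -1; 0, x] : Matrix (Fin 2) (Fin 2) R) ^ (m + 1) =
      !![0, -x ^ m; 0, x ^ (m + 1)] := by
    clear hV
    induction m with
    | zero => simp
    | succ m ih =>
      rw [pow_succ, ih, Matrix.mul_fin_two]
      simp [pow_succ, mul_assoc]
  have hNV : (!![0, 0; x, x] : Matrix (Fin 2) (Fin 2) R) ^ (m + 1) =
      !![0, 0; x ^ (m + 1), x ^ (m + 1)] := by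
    clear hV hNU
    induction m with
    | zero => simp
    | succ m ih =>
      rw [pow_succ, ih, Matrix.mul_fin_two]
      simp [pow_succ, mul_assoc]
  have hU := (matTop_gradedRep_wordU x).pow (m + 1)
  have hM' := hM.pow (m + 1)
  rw [hNU] at hU
  rw [hNV] at hM'
  set P := repMat (gradedRep x) wordU ^ (m + 1)
  set Q := M ^ (m + 1)
  rw [one_mul] at hU hM'
  have htr : (P * (D * Q * D')).trace = P 0 0 * Q 0 0 + P 0 1 * (Q 1 0 * LaurentPolynomial.T 1) +
      P 1 0 * (Q 0 1 * LaurentPolynomial.T (-1)) + P 1 1 * Q 1 1 := by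
    have hD00 : D 0 0 = 1 := rfl
    have hD01 : D 0 1 = 0 := rfl
    have hD10 : D 1 0 = 0 := rfl
    have hD11 : D 1 1 = LaurentPolynomial.T 1 := rfl
    have hD00' : D' 0 0 = 1 := rfl
    have hD01' : D' 0 1 = 0 := rfl
    have hD10' : D' 1 0 = 0 := rfl
    have hD11' : D' 1 1 = LaurentPolynomial.T (-1) := rfl
    simp only [Matrix.trace_fin_two, Matrix.mul_apply, Fin.sum_univ_two, hD00, hD01, hD10, hD11,
      hD00', hD01', hD10', hD11']
    linear_combination (P 1 1 * Q 1 1) * h'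
  rw [word_even, map_mul, map_pow, map_pow, hV, htr]
  have h00 := ((hU 0 0).mul (hM' 0 0)).lower (e := 2 * (m + 1 : ℕ) + 1) (by linarith)
  have h01 := (hU 0 1).mul ((hM' 1 0).mul (HasTop.T 1))
  have h10 := ((hU 1 0).mul ((hM' 0 1).mul (HasTop.T (-1)))).lower
    (e := 2 * (m + 1 : ℕ) + 1) (by linarith)
  have h11 := ((hU 1 1).mul (hM' 1 1)).lower (e := 2 * (m + 1 : ℕ) + 1) (by linarith)
  have hdeg : ((m + 1 : ℕ) : ℤ) + ((m + 1 : ℕ) + 1) = 2 * (m + 1 : ℕ) + 1 := by ring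
  rw [hdeg] at h01
  convert ((h00.add h01).add h10).add h11 using 1
  simp
  ring

/-! ### Total degree as degree in `T`. -/

/-- The substitution `s ↦ T`, `y ↦ X T`, which makes the total degree the degree in `T`. -/
noncomputable def gradedEval : PolySY →+* (Polynomial ℤ)[T;T⁻¹] :=
  Polynomial.eval₂RingHom
    (LaurentPolynomial.eval₂ (LaurentPolynomial.C.comp Polynomial.C) (unitT (Polynomial ℤ)))
    (LaurentPolynomial.C Polynomial.X * LaurentPolynomial.T 1)

theorem gradedEval_comp_universalRep :
    (Matrix.SpecialLinearGroup.map gradedEval).comp universalRep = gradedRep Polynomial.X := by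
  rw [universalRep, map_comp_rileyRep, gradedRep]
  congr 1
  · ext1
    simp [gradedEval, indetS]
  · simp [gradedEval]

/-- The monomial `s^i y^j` goes to `X^j T^(i+j)`; distinct monomials stay distinct, so nothing
cancels. -/
theorem coeff_gradedEval (f : PolySY) (n : ℤ) (j : ℕ) :
    ((gradedEval f).coeff n).coeff j = (f.coeff j).coeff (n - j) := by
  induction f using Polynomial.induction_on' with
  | add f g hf hg => simp [hf, hg]
  | monomial l p =>
    induction p using LaurentPolynomial.induction_on' with
    | add p p' hp hp' =>
      simp only [map_add, Polynomial.coeff_add, AddMonoidAlgebra.coeff_add, Finsupp.add_apply,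
        hp, hp']
    | C_mul_T i a =>
      have h : gradedEval (Polynomial.monomial l (LaurentPolynomial.C a * LaurentPolynomial.T i)) =
          AddMonoidAlgebra.single (i + l) (Polynomial.monomial l a) := by
        rw [LaurentPolynomial.single_eq_C_mul_T, gradedEval, Polynomial.coe_eval₂RingHom,
          Polynomial.eval₂_monomial, LaurentPolynomial.eval₂_C_mul_T, coe_unitT_zpow, mul_pow,
          LaurentPolynomial.T_pow, LaurentPolynomial.T_add, ← Polynomial.C_mul_X_pow_eq_monomial,
          map_mul, map_pow, mul_one, RingHom.comp_apply]
        ring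
      rw [h, Polynomial.coeff_monomial, AddMonoidAlgebra.coeff_single, Finsupp.single_apply,
        ← LaurentPolynomial.single_eq_C_mul_T]
      by_cases hl : l = j
      · subst hl
        rw [if_pos rfl, AddMonoidAlgebra.coeff_single, Finsupp.single_apply]
        by_cases hi : i + l = n
        · simp [eq_sub_of_add_eq hi]
        · rw [if_neg hi, if_neg (fun h => hi (by omega))]
          simp
      · rw [if_neg hl]
        split_ifs <;> simp [Polynomial.coeff_monomial, hl]

theorem degSY_eq_of_hasTop {f : PolySY} {d : ℤ} {c : Polynomial ℤ}
    (h : HasTop (gradedEval f) d c) (hc : c ≠ 0) : degSY f = d := by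
  apply le_antisymm
  · refine Finset.sup_le fun j _ => ?_
    have hj : (f.coeff j).degree ≤ ((d - j : ℤ) : WithBot ℤ) := by
      refine Finset.max_le fun i hi => ?_
      rw [WithBot.coe_le_coe]
      by_contra! hlt
      rw [Finsupp.mem_support_iff] at hi
      apply hi
      have := coeff_gradedEval f (i + j) j
      rwa [h.2 _ (by omega), Polynomial.coeff_zero, add_sub_cancel_right, eq_comm] at this
    calc (f.coeff j).degree + ((j : ℤ) : WithBot ℤ)
        ≤ ((d - j : ℤ) : WithBot ℤ) + ((j : ℤ) : WithBot ℤ) := by gcongr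
      _ = d := by rw [← WithBot.coe_add, sub_add_cancel]
  · obtain ⟨j, hj⟩ : ∃ j, c.coeff j ≠ 0 := by
      by_contra! h0
      exact hc (Polynomial.ext (by simpa using h0))
    rw [← h.1, coeff_gradedEval] at hj
    have hsupp : j ∈ f.support := by
      rw [Polynomial.mem_support_iff]
      rintro h0
      simp [h0] at hj
    have hdeg : ((d - j : ℤ) : WithBot ℤ) ≤ (f.coeff j).degree :=
      Finset.le_max (Finsupp.mem_support_iff.mpr hj)
    calc (d : WithBot ℤ) = ((d - j : ℤ) : WithBot ℤ) + ((j : ℤ) : WithBot ℤ) := by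
          rw [← WithBot.coe_add, sub_add_cancel]
      _ ≤ (f.coeff j).degree + ((j : ℤ) : WithBot ℤ) := by gcongr
      _ ≤ degSY f := Finset.le_sup (f := fun j => (f.coeff j).degree + ((j : ℤ) : WithBot ℤ)) hsupp

/-! ### The degree of the leading coefficient, case by case. -/

theorem hasTop_det_geomMat {ρ : FreeGroup (Fin 2) →* SL(2, R[T;T⁻¹])} {g : FreeGroup (Fin 2)}
    {d : ℤ} {c : R} (hd : 0 < d) (h : HasTop (repMat ρ g).trace d c) (n : ℕ) :
    HasTop (geomMat ρ (n + 1) g).det (d * n) (c ^ n) :=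
  hasTop_det_geomSum (det_repMat ρ g) hd h n

/-- The total degree of the leading coefficient in terms of `k` and `q`. -/
theorem degSY_leadCoeff {k : ℕ} {q : ℤ} {d : ℤ} {c : Polynomial ℤ}
    (h : HasTop (leadCoeff k q (gradedRep Polynomial.X)) d c) (hc : c ≠ 0) :
    degSY (leadCoeff k q universalRep) = d := by
  refine degSY_eq_of_hasTop ?_ hc
  rwa [map_leadCoeff, gradedEval_comp_universalRep]

theorem degSY_leadCoeff_even {k : ℕ} (q : ℤ) (hk : 0 < k) (hq : q ≠ 0) (he : Even k) :
    degSY (leadCoeff k q universalRep) =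
      (((k + 1) * |q| - (k + 4) / 2 : ℤ) : WithBot ℤ) := by
  obtain ⟨m, rfl⟩ : ∃ m, k = 2 * (m + 1) := by
    obtain ⟨m, rfl⟩ := he
    exact ⟨m - 1, by omega⟩
  obtain ⟨p, hp⟩ : ∃ p, q.natAbs = p + 1 := ⟨q.natAbs - 1, by omega⟩
  -- With `p = |q| - 1` and `m = k/2 - 1`, the factors have degrees `(k + 1)(|q| - 1)` and `k/2 -
  -- 1`.
  have h := (hasTop_det_geomMat (by positivity) (hasTop_trace_word_even Polynomial.X m) p).mul
    (hasTop_det_geomMat one_pos (hasTop_trace_wordU (Polynomial.X : Polynomial ℤ)) m)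
  have hψ : leadCoeff (2 * (m + 1)) q (gradedRep (Polynomial.X : Polynomial ℤ)) = _ := if_pos he
  rw [hp, Nat.mul_div_cancel_left _ two_pos] at hψ
  rw [← hψ] at h
  rw [degSY_leadCoeff h (by simp)]
  congr 1
  rw [Int.abs_eq_natAbs, hp]
  have : ((2 * (m + 1) : ℕ) + 4 : ℤ) / 2 = m + 3 := by omega
  rw [this]
  push_cast
  ring

theorem degSY_leadCoeff_odd_pos {k : ℕ} {q : ℤ} (ho : Odd k) (h1 : k ≠ 1) (hq : 0 < q) :
    degSY (leadCoeff k q universalRep) = (((k - 3) / 2 : ℤ) : WithBot ℤ) := by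
  obtain ⟨m, rfl⟩ : ∃ m, k = 2 * (m + 1) + 1 := by
    obtain ⟨m, rfl⟩ := ho
    exact ⟨m - 1, by omega⟩
  have h := hasTop_det_geomMat one_pos (hasTop_trace_wordV (Polynomial.X : Polynomial ℤ)) m
  have hψ : leadCoeff (2 * (m + 1) + 1) q (gradedRep (Polynomial.X : Polynomial ℤ)) =
      (geomMat (gradedRep Polynomial.X) (m + 1) wordV).det := by
    rw [leadCoeff, if_neg (by simp), if_neg (by omega), if_neg h1]
    congr 2
    omega
  rw [← hψ] at h
  rw [degSY_leadCoeff h (by simp)]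
  congr 1
  omega

theorem degSY_leadCoeff_odd_neg {k : ℕ} {q : ℤ} (ho : Odd k) (hq : q < 0) :
    degSY (leadCoeff k q universalRep) = (((k - 1) / 2 : ℤ) : WithBot ℤ) := by
  have h := hasTop_det_geomMat one_pos (hasTop_trace_wordV (Polynomial.X : Polynomial ℤ)) (k / 2)
  have hψ : leadCoeff k q (gradedRep (Polynomial.X : Polynomial ℤ)) =
      (geomMat (gradedRep Polynomial.X) (k / 2 + 1) wordV).det := by
    rw [leadCoeff, if_neg (by simpa using ho), if_pos hq]
  rw [← hψ] at h
  rw [degSY_leadCoeff h (by simp)]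
  obtain ⟨m, rfl⟩ := ho
  congr 1
  omega

theorem degSY_leadCoeff_one_pos {q : ℤ} (hq : 0 < q) :
    degSY (leadCoeff 1 q universalRep) = 0 := by
  have hψ : leadCoeff 1 q (gradedRep (Polynomial.X : Polynomial ℤ)) = 1 := by
    rw [leadCoeff, if_neg (by decide), if_neg (by omega), if_pos rfl]
  have h := HasTop.one (R := Polynomial ℤ)
  rw [← hψ] at h
  exact degSY_leadCoeff h one_ne_zero

/-- The degree is an integer in every case, whereas that of 0 is `⊥`. -/
theorem leadCoeff_universalRep_ne_zero {k : ℕ} {q : ℤ} (hk : 0 < k) (hq : q ≠ 0) :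
    leadCoeff k q universalRep ≠ 0 := by
  have key : ∃ d : ℤ, degSY (leadCoeff k q universalRep) = d := by
    rcases k.even_or_odd with he | ho
    · exact ⟨_, degSY_leadCoeff_even q hk hq he⟩
    · rcases hq.lt_or_gt with hneg | hpos
      · exact ⟨_, degSY_leadCoeff_odd_neg ho hneg⟩
      · by_cases h1 : k = 1
        · exact ⟨0, h1 ▸ degSY_leadCoeff_one_pos hpos⟩
        · exact ⟨_, degSY_leadCoeff_odd_pos ho h1 hpos⟩
  rintro h0
  obtain ⟨d, hd⟩ := key
  rw [h0] at hd
  simp [degSY] at hd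

theorem comp_mk_eq_map_universalRep {k : ℕ} {q : ℤ} {s : ℂˣ} {y : ℂ}
    {ρ : knotGroup k q →* SL(2, ℂ)} (ha : ρ (PresentedGroup.of 0) = matA s)
    (hb : ρ (PresentedGroup.of 1) = matB s y) :
    ρ.comp (PresentedGroup.mk {relator k q}) =
      (Matrix.SpecialLinearGroup.map (evalSY s y)).comp universalRep := by
  have hs : Units.map (evalSY s y : PolySY →* ℂ) indetS = s := by
    ext1
    simp [evalSY, indetS]
  have hy : evalSY s y Polynomial.X = y := by simp [evalSY]
  rw [universalRep, map_comp_rileyRep, hs, hy]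
  ext j : 1
  fin_cases j
  · exact ha.trans (by simp [rileyRep])
  · exact hb.trans (by simp [rileyRep])

end Degree

end DoubleTwist

theorem proposition5p3 (k : ℕ) (q : ℤ) (hk : 0 < k) (hq : q ≠ 0) :
    ∃ (n : ℤ) (ψ : PolySY),
      -- `ψ` is the coefficient of the highest degree term (which is `t ^ n`) of the twisted
      -- Alexander polynomial, formed with indeterminates `s` and `y`, for both choices of `j`
      ψ ≠ 0 ∧
      (∀ j : Fin 2, HasTopTerm (twistedAlexander (relator k q) universalRep j) n ψ) ∧
      -- for every representation of the knot group of this form, `ψ (s, y)` is the coefficient of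
      -- `t ^ n`, and no higher power of `t` occurs
      (∀ (s : ℂˣ) (y : ℂ) (ρ : knotGroup k q →* SL(2, ℂ)),
        ρ (PresentedGroup.of 0) = matA s → ρ (PresentedGroup.of 1) = matB s y →
        ∀ j : Fin 2, HasTopTerm
          (twistedAlexander (relator k q) (ρ.comp (PresentedGroup.mk {relator k q})) j) n
          (evalSY s y ψ)) ∧
      -- the degree of `ψ` (the divisions by 2 are exact)
      (Even k → degSY ψ = (((k + 1) * |q| - (k + 4) / 2 : ℤ) : WithBot ℤ)) ∧
      (Odd k → k ≠ 1 → 0 < q → degSY ψ = (((k - 3) / 2 : ℤ) : WithBot ℤ)) ∧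
      (Odd k → q < 0 → degSY ψ = (((k - 1) / 2 : ℤ) : WithBot ℤ)) ∧
      (k = 1 → 0 < q → degSY ψ = 0) := by
  refine ⟨topDegree k q - 2, leadCoeff k q universalRep, leadCoeff_universalRep_ne_zero hk hq,
    fun j => hasTopTerm_twistedAlexander universalRep j k hq, fun s y ρ ha hb j => ?_,
    degSY_leadCoeff_even q hk hq, degSY_leadCoeff_odd_pos, degSY_leadCoeff_odd_neg, ?_⟩
  · rw [map_leadCoeff, ← comp_mk_eq_map_universalRep ha hb]
    exact hasTopTerm_twistedAlexander _ j k hq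
  · rintro rfl
    exact degSY_leadCoeff_one_pos
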